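/- A \emph{stem extension} of a finite group $G$ is a surjective group homomorphism $\pi:\hat G\to G$ with $\ker\pi\subseteq Z(\hat G)\cap[\hat G,\hat G]$; a \emph{Schur cover} of $G$ is a stem extension $\pi:\tilde G\to G$ for which $|\tilde G|$ is maximal. Given a Schur cover $\pi:\tilde G\to G$, the \emph{deep commuting graph} $\Delta_D(G)$ is the simple graph with vertex set $G$ in which two distinct elements $g,h$ are adjacent if and only if their preimages commute in $\tilde G$, i.e. $xy=yx$ for all $x\in\pi^{-1}(g)$ and $y\in\pi^{-1}(h)$. For a graph $\Gamma$, the \emph{reduced graph} $\Gamma^*$ is the subgraph induced on the vertices of $\Gamma$ that are not adjacent to all other vertices. Let $n\ge 6$ be an integer, let $S_n$ be the symmetric group on $n$ letters, and form $\Delta_D(S_n)$ with any Schur cover of $S_n$. Then $\Delta_D(S_n)^*$ is connected if and only if neither $n$ nor $n-1$ is prime. Moreover, suppose that $\Delta_D(S_n)^*$ is disconnected. Then: (i) if $n$ is prime, then $\Delta_D(S_n)^*$ has exactly $(n-2)!+1$ connected components; (ii) if $n-1$ is prime, then $\Delta_D(S_n)^*$ has exactly $n\,(n-3)!+1$ connected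 components. -/

import Mathlib

universe u v

namespace DeepCommuting

/-- A group homomorphism `π : E →* G` is a stem extension of `G`: it is surjective and its kernel
is contained in the intersection of the centre and the derived subgroup of `E`. -/
structure IsStemExtension {E : Type u} {G : Type v} [Group E] [Group G] (π : E →* G) : Prop where
  surjective : Function.Surjective π
  ker_le_center : π.ker ≤ Subgroup.center E
  ker_le_commutator : π.ker ≤ commutator E

/-- `π : E →* G` is a Schur cover of the finite group `G`: a stem extension of maximal order.
(Every stem extension of a finite group is finite, and every finite group has a copy in each
universe, so comparing with the finite `E'` in the universe of `E` is no restriction.) -/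
structure IsSchurCover {E : Type u} {G : Type v} [Group E] [Group G] (π : E →* G) : Prop where
  finite : Finite E
  isStemExtension : IsStemExtension π
  card_le : ∀ (E' : Type u) [Group E'] [Finite E'] (π' : E' →* G),
    IsStemExtension π' → Nat.card E' ≤ Nat.card E

/-- The deep commuting graph of `G` computed in the Schur cover `π : E →* G`: two distinct
elements of `G` are adjacent if their preimages commute in `E`. -/
def deepCommutingGraph {E : Type u} {G : Type v} [Group E] [Group G] (π : E →* G) :
    SimpleGraph G where
  Adj g h := g ≠ h ∧ ∀ x y : E, π x = g → π y = h → x * y = y * x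
  symm := ⟨fun _ _ hgh => ⟨hgh.1.symm, fun x y hx hy => (hgh.2 y x hy hx).symm⟩⟩
  loopless := ⟨fun _ h => h.1 rfl⟩

/-- The reduced graph `Γ*`: the subgraph induced on the vertices that are not dominant, i.e. not
adjacent to all other vertices. -/
abbrev reducedGraph {V : Type v} (Γ : SimpleGraph V) :
    SimpleGraph ((Γ.universalVertsᶜ : Set V)) :=
  Γ.induce Γ.universalVertsᶜ

/-- The order of a stem extension of a finite group is bounded. -/
theorem exists_card_bound (G : Type v) [Group G] [Finite G] :
    ∃ B : ℕ, ∀ (E : Type u) [Group E] [Finite E] (π : E →* G),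
      IsStemExtension π → Nat.card E ≤ B := by
  refine ⟨(Finset.range (Nat.card (G × G) + 1)).sup Subgroup.cardCommutatorBound * Nat.card G, ?_⟩
  intro E _ _ π hπ
  obtain ⟨s, hs⟩ := hπ.surjective.hasRightInverse
  have hsub : commutatorSet E ⊆ Set.range (fun p : G × G => s p.1 * s p.2 * (s p.2 * s p.1)⁻¹) := by
    rintro _ ⟨x, y, rfl⟩
    refine ⟨(π x, π y), ?_⟩
    have hk : ∀ x : E, (s (π x))⁻¹ * x ∈ Subgroup.center E := fun x =>
      hπ.ker_le_center (by rw [MonoidHom.mem_ker, map_mul, map_inv, hs (π x)]; simp)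
    obtain ⟨a, ha⟩ : ∃ a, a = (s (π x))⁻¹ * x := ⟨_, rfl⟩
    obtain ⟨b, hb⟩ : ∃ b, b = (s (π y))⁻¹ * y := ⟨_, rfl⟩
    have hac := hk x
    have hbc := hk y
    rw [← ha] at hac
    rw [← hb] at hbc
    rw [Subgroup.mem_center_iff] at hac hbc
    have hx : x = s (π x) * a := by rw [ha]; group
    have hy : y = s (π y) * b := by rw [hb]; group
    have h1 : x * y = s (π x) * s (π y) * (a * b) := by
      calc x * y = s (π x) * a * (s (π y) * b) := by rw [← hx, ← hy]
        _ = s (π x) * s (π y) * (a * b) := by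
          rw [mul_assoc, ← mul_assoc a _ b, ← hac (s (π y))]; group
    have h2 : y * x = s (π y) * s (π x) * (a * b) := by
      calc y * x = s (π y) * b * (s (π x) * a) := by rw [← hx, ← hy]
        _ = s (π y) * s (π x) * (a * b) := by
          rw [mul_assoc, ← mul_assoc b _ a, ← hbc (s (π x)), mul_assoc _ b a, ← hbc a]; group
    have h3 : x * y * x⁻¹ * y⁻¹ = x * y * (y * x)⁻¹ := by group
    rw [commutatorElement_def, h3, h1, h2]
    group
  have hcard : Nat.card (commutatorSet E) ≤ Nat.card (G × G) :=
    (Nat.card_mono (Set.finite_range _) hsub).trans (Finite.card_range_le _)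
  have h1 := Subgroup.card_commutator_le_of_finite_commutatorSet E
  have h2 : Nat.card π.ker ≤ Nat.card (commutator E) :=
    Nat.card_mono (Set.toFinite _) hπ.ker_le_commutator
  have h3 : Subgroup.cardCommutatorBound (Nat.card (commutatorSet E)) ≤
      (Finset.range (Nat.card (G × G) + 1)).sup Subgroup.cardCommutatorBound :=
    Finset.le_sup (f := Subgroup.cardCommutatorBound) (Finset.mem_range.2 (by omega))
  have h4 : Nat.card E = Nat.card π.ker * Nat.card G := by
    rw [← π.ker.card_mul_index, Subgroup.index_ker, MonoidHom.range_eq_top.2 hπ.surjective]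
    simp
  rw [h4]
  exact Nat.mul_le_mul_right _ (h2.trans (h1.trans h3))

/-- Every finite group has a Schur cover. -/
theorem exists_isSchurCover (G : Type u) [Group G] [Finite G] :
    ∃ (E : Type u) (_ : Group E) (π : E →* G), IsSchurCover π := by
  obtain ⟨B, hB⟩ := exists_card_bound.{u, u} G
  let P : ℕ → Prop := fun m => ∃ (E : Type u) (_ : Group E) (_ : Finite E) (π : E →* G),
    IsStemExtension π ∧ Nat.card E = m
  have hid : IsStemExtension (MonoidHom.id G) := by
    have hk : (MonoidHom.id G).ker = ⊥ := (MonoidHom.ker_eq_bot_iff _).2 fun _ _ h => h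
    exact ⟨fun g => ⟨g, rfl⟩, hk ▸ bot_le, hk ▸ bot_le⟩
  have h0 : P (Nat.card G) := ⟨G, inferInstance, inferInstance, MonoidHom.id G, hid, rfl⟩
  classical
  have hbd : ∀ m, P m → m ≤ B := by
    rintro m ⟨E, _, _, π, hπ, rfl⟩
    exact hB E π hπ
  obtain ⟨E, iE, iF, π, hπ, hc⟩ := Nat.findGreatest_spec (hbd _ h0) h0
  refine ⟨E, iE, π, iF, hπ, fun E' _ _ π' hπ' => ?_⟩
  have hP : P (Nat.card E') := ⟨E', inferInstance, inferInstance, π', hπ', rfl⟩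
  rw [hc]
  exact Nat.le_findGreatest (hbd _ hP) hP

end DeepCommuting

/-!
In a central extension of `G` the commutator of lifts of two commuting elements is central, depends
only on the two elements, is multiplicative in each of them, and is therefore killed by both orders.
So commuting elements of coprime orders deep commute, as do commuting `g` and `h` if `g` has odd
order and is inverted by some element commuting with `h`.

In the symmetric group on `n ≥ 6` points two transpositions with a common point deep commute with a
3-cycle disjoint from both, so all transpositions lie in one component, and every `g ≠ 1` is joined
to a power of itself of prime order `p`.
* If `p` is odd and two points are fixed, the element deep commutes with the transposition of these
  two points. Otherwise, unless it is a cycle of length at least `n - 1`, it deep commutes with any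
  of its cycles, since a cycle is inverted by a permutation of its support, and that cycle fixes two
  points.
* An involution `g` moving more than four points commutes with `t * (g * t * g⁻¹)`, which has order
  3 for a suitable 3-cycle `t`. A product of two disjoint transpositions is of the form
  `s * (t * s * t⁻¹)` with `s` an involution, so the commutator with a disjoint transposition is a
  square of an element of order at most two.

What remains are the cycles of prime length `q ≥ n - 1`. They generate their own centralizers, so
the `q - 1` nontrivial powers of each form a component, and there are `(q - 1)! * n.choose q` such
cycles.
-/

namespace DeepCommuting

open scoped commutatorElement

section Group

variable {G : Type*} [Group G] {g h t : G}

theorem commute_mul_conj (h2 : g ^ 2 = 1) (h : Commute t (g * t * g⁻¹)) :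
    Commute g (t * (g * t * g⁻¹)) := by
  have hinv : g⁻¹ = g := inv_eq_of_mul_eq_one_left (by rw [← pow_two, h2])
  calc g * (t * (g * t * g⁻¹)) = g * ((g * t * g⁻¹) * t) := by rw [h.eq]
    _ = g ^ 2 * t * g⁻¹ * t := by simp only [pow_two, mul_assoc]
    _ = t * g * t := by rw [h2, one_mul, hinv]
    _ = t * (g * t * g⁻¹) * g := by simp only [mul_assoc, inv_mul_cancel, mul_one]

theorem orderOf_eq_of_mem_zpowers_of_prime (hp : (orderOf g).Prime)
    (hh : h ∈ Subgroup.zpowers g) (h1 : h ≠ 1) : orderOf h = orderOf g :=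
  (hp.eq_one_or_self_of_dvd _ (orderOf_dvd_of_mem_zpowers hh)).resolve_left
    fun e => h1 (orderOf_eq_one_iff.1 e)

theorem ncard_zpowers_sdiff_one (g : G) :
    (Subgroup.zpowers g \ {1} : Set G).ncard = orderOf g - 1 := by
  rw [Set.ncard_sdiff_singleton_of_mem (Subgroup.one_mem _), ← Nat.card_zpowers]
  rfl

end Group

section Commutator

variable {E : Type*} [Group E] {x x' y t : E}

theorem commutatorElement_mul_left_of_mem_center (h : ⁅x', y⁆ ∈ Subgroup.center E) :
    ⁅x * x', y⁆ = ⁅x, y⁆ * ⁅x', y⁆ := by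
  have hcomm := Subgroup.mem_center_iff.1 h
  rw [commutatorElement_mul_left_eq_conj_mul, hcomm x, mul_inv_cancel_right, hcomm]

theorem commutatorElement_pow_left_of_mem_center (h : ⁅x, y⁆ ∈ Subgroup.center E) (m : ℕ) :
    ⁅x ^ m, y⁆ = ⁅x, y⁆ ^ m := by
  induction m with
  | zero => simp
  | succ m ih => rw [pow_succ, commutatorElement_mul_left_of_mem_center h, ih, pow_succ]

theorem commutatorElement_conj_left_of_mem_center (hx : ⁅x, y⁆ ∈ Subgroup.center E)
    (ht : ⁅t, y⁆ ∈ Subgroup.center E) : ⁅t * x * t⁻¹, y⁆ = ⁅x, y⁆ := by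
  refine mul_right_cancel (b := ⁅t, y⁆) ?_
  rw [← commutatorElement_mul_left_of_mem_center ht, inv_mul_cancel_right,
    commutatorElement_mul_left_of_mem_center hx, Subgroup.mem_center_iff.1 hx]

end Commutator

section CentralExtension

variable {E : Type u} {G : Type v} [Group E] [Group G] {π : E →* G} {x x' y : E} {g h k s t : G}

/-- A group homomorphism `π : E →* G` is a central extension of `G`: it is surjective with central
kernel. The commutator of two elements of `E` then depends only on their images in `G`. -/
structure IsCentralExtension (π : E →* G) : Prop where
  surjective : Function.Surjective π
  ker_le_center : π.ker ≤ Subgroup.center E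

theorem IsStemExtension.isCentralExtension (hπ : IsStemExtension π) : IsCentralExtension π :=
  ⟨hπ.surjective, hπ.ker_le_center⟩

/-- Two elements of `G` deep commute in `π : E →* G` if all their preimages commute. Together with
`g ≠ h` this is adjacency in the deep commuting graph. -/
def DeepCommute (π : E →* G) (g h : G) : Prop :=
  ∀ x y : E, π x = g → π y = h → x * y = y * x

theorem DeepCommute.commute (hs : Function.Surjective π) (H : DeepCommute π g h) :
    Commute g h := by
  obtain ⟨x, rfl⟩ := hs g
  obtain ⟨y, rfl⟩ := hs h
  exact Commute.map (H x y rfl rfl) π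

theorem commutatorElement_congr_left (hk : π.ker ≤ Subgroup.center E) (h : π x = π x') :
    ⁅x, y⁆ = ⁅x', y⁆ := by
  have hcentral : x'⁻¹ * x ∈ Subgroup.center E :=
    hk (by rw [MonoidHom.mem_ker, map_mul, map_inv, h, inv_mul_cancel])
  have hone : ⁅x'⁻¹ * x, y⁆ = 1 := commutatorElement_eq_one_iff_mul_comm.2
    (Subgroup.mem_center_iff.1 hcentral y).symm
  rw [← mul_inv_cancel_left x' x, commutatorElement_mul_left_of_mem_center
    (hone ▸ Subgroup.one_mem _), hone, mul_one]

theorem deepCommute_map_iff (hk : π.ker ≤ Subgroup.center E) :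
    DeepCommute π (π x) (π y) ↔ ⁅x, y⁆ = 1 := by
  refine ⟨fun H => commutatorElement_eq_one_iff_mul_comm.2 (H x y rfl rfl), ?_⟩
  intro hxy x' y' hx hy
  rw [← commutatorElement_eq_one_iff_mul_comm, commutatorElement_congr_left hk hx,
    ← commutatorElement_inv, commutatorElement_congr_left hk hy, commutatorElement_inv, hxy]

theorem commutatorElement_mem_center_of_commute_map (hk : π.ker ≤ Subgroup.center E)
    (h : Commute (π x) (π y)) : ⁅x, y⁆ ∈ Subgroup.center E :=
  hk <| by rwa [MonoidHom.mem_ker, map_commutatorElement, commutatorElement_eq_one_iff_commute]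

theorem commutatorElement_pow_orderOf_map (hk : π.ker ≤ Subgroup.center E)
    (h : Commute (π x) (π y)) : ⁅x, y⁆ ^ orderOf (π x) = 1 := by
  rw [← commutatorElement_pow_left_of_mem_center
    (commutatorElement_mem_center_of_commute_map hk h), commutatorElement_congr_left (x' := 1) hk
    (by rw [map_pow, pow_orderOf_eq_one, map_one]), commutatorElement_one_left]

theorem deepCommute_one_left (hk : π.ker ≤ Subgroup.center E) (h : G) : DeepCommute π 1 h :=
  fun _ y hx _ => (Subgroup.mem_center_iff.1 (hk (MonoidHom.mem_ker.2 hx)) y).symm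

namespace IsCentralExtension

theorem deepCommute_of_mem_zpowers (hπ : IsCentralExtension π) (h : k ∈ Subgroup.zpowers g) :
    DeepCommute π g k := by
  obtain ⟨m, rfl⟩ := h
  obtain ⟨x, rfl⟩ := hπ.surjective g
  dsimp only
  rw [← map_zpow, deepCommute_map_iff hπ.ker_le_center, commutatorElement_eq_one_iff_commute]
  exact (Commute.refl x).zpow_right m

theorem deepCommute_mul_right (hπ : IsCentralExtension π) (H : DeepCommute π g h)
    (K : DeepCommute π g k) : DeepCommute π g (h * k) := by
  obtain ⟨x, rfl⟩ := hπ.surjective g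
  obtain ⟨y, rfl⟩ := hπ.surjective h
  obtain ⟨z, rfl⟩ := hπ.surjective k
  rw [← map_mul, deepCommute_map_iff hπ.ker_le_center, commutatorElement_eq_one_iff_commute]
  exact Commute.mul_right (H x y rfl rfl) (K x z rfl rfl)

theorem deepCommute_of_coprime (hπ : IsCentralExtension π) (hc : Commute g h)
    (ho : (orderOf g).Coprime (orderOf h)) : DeepCommute π g h := by
  obtain ⟨x, rfl⟩ := hπ.surjective g
  obtain ⟨y, rfl⟩ := hπ.surjective h
  have hx : ⁅x, y⁆ ^ orderOf (π x) = 1 := commutatorElement_pow_orderOf_map hπ.ker_le_center hc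
  have hy : ⁅x, y⁆ ^ orderOf (π y) = 1 := by
    rw [← commutatorElement_inv, inv_pow,
      commutatorElement_pow_orderOf_map hπ.ker_le_center hc.symm, inv_one]
  rw [deepCommute_map_iff hπ.ker_le_center, ← pow_one ⁅x, y⁆, ← ho.gcd_eq_one]
  exact pow_gcd_eq_one.2 ⟨hx, hy⟩

theorem deepCommute_of_conj_eq_inv (hπ : IsCentralExtension π) (hgh : Commute g h)
    (hth : Commute t h) (ho : Odd (orderOf g)) (ht : t * g * t⁻¹ = g⁻¹) : DeepCommute π g h := by
  obtain ⟨x, rfl⟩ := hπ.surjective g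
  obtain ⟨y, rfl⟩ := hπ.surjective h
  obtain ⟨t, rfl⟩ := hπ.surjective t
  have hk := hπ.ker_le_center
  have hx := commutatorElement_mem_center_of_commute_map hk hgh
  -- Both sides are the commutator of a lift of `t * g * t⁻¹` with `y`.
  have hinv : ⁅x⁻¹, y⁆ = ⁅x, y⁆ := by
    rw [← commutatorElement_conj_left_of_mem_center hx
      (commutatorElement_mem_center_of_commute_map hk hth)]
    exact commutatorElement_congr_left hk (by simpa using ht.symm)
  have hsq : ⁅x, y⁆ ^ 2 = 1 := by
    nth_rw 1 [pow_two, ← hinv]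
    rw [← commutatorElement_mul_left_of_mem_center hx, inv_mul_cancel, commutatorElement_one_left]
  rw [deepCommute_map_iff hk, ← pow_one ⁅x, y⁆, ← ho.coprime_two_left.gcd_eq_one]
  exact pow_gcd_eq_one.2 ⟨hsq, commutatorElement_pow_orderOf_map hk hgh⟩

theorem deepCommute_mul_conj (hπ : IsCentralExtension π) (hsh : Commute s h) (hth : Commute t h)
    (hs : s ^ 2 = 1) : DeepCommute π (s * (t * s * t⁻¹)) h := by
  obtain ⟨x, rfl⟩ := hπ.surjective s
  obtain ⟨y, rfl⟩ := hπ.surjective h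
  obtain ⟨t, rfl⟩ := hπ.surjective t
  have hk := hπ.ker_le_center
  have hx := commutatorElement_mem_center_of_commute_map hk hsh
  have hconj : ⁅t * x * t⁻¹, y⁆ = ⁅x, y⁆ := commutatorElement_conj_left_of_mem_center hx
    (commutatorElement_mem_center_of_commute_map hk hth)
  rw [← map_inv, ← map_mul, ← map_mul, ← map_mul, deepCommute_map_iff hk,
    commutatorElement_mul_left_of_mem_center (hconj ▸ hx), hconj, ← pow_two,
    ← commutatorElement_pow_left_of_mem_center hx,
    commutatorElement_congr_left (x' := 1) hk (by rw [map_pow, hs, map_one]),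
    commutatorElement_one_left]

end IsCentralExtension

end CentralExtension

section Linked

variable {E : Type u} {G : Type v} [Group E] [Group G] {π : E →* G} {g h k : G}

/-- `g` and `h` are vertices of the reduced deep commuting graph of `G` and lie in the same
component of it. Being a vertex is part of the relation, so that elements of `G` can be compared
without passing to the subtype of vertices. -/
def Linked (π : E →* G) (g h : G) : Prop :=
  ∃ (hg : g ∈ (deepCommutingGraph π).universalVertsᶜ)
    (hh : h ∈ (deepCommutingGraph π).universalVertsᶜ),
    (reducedGraph (deepCommutingGraph π)).Reachable ⟨g, hg⟩ ⟨h, hh⟩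

theorem Linked.symm : Linked π g h → Linked π h g :=
  fun ⟨hg, hh, H⟩ => ⟨hh, hg, H.symm⟩

theorem Linked.trans : Linked π g h → Linked π h k → Linked π g k :=
  fun ⟨hg, _, H⟩ ⟨_, hk, K⟩ => ⟨hg, hk, H.trans K⟩

theorem linked_coe_iff {g h : ((deepCommutingGraph π).universalVertsᶜ : Set G)} :
    Linked π g h ↔ (reducedGraph (deepCommutingGraph π)).Reachable g h :=
  ⟨fun ⟨_, _, H⟩ => H, fun H => ⟨g.2, h.2, H⟩⟩

theorem ne_one_of_mem_compl_universalVerts (hk : π.ker ≤ Subgroup.center E)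
    (hg : g ∈ (deepCommutingGraph π).universalVertsᶜ) : g ≠ 1 := by
  rintro rfl
  exact hg fun h hne => ⟨hne, deepCommute_one_left hk h⟩

namespace IsCentralExtension

theorem mem_compl_universalVerts_iff (hπ : IsCentralExtension π) (hG : Subgroup.center G = ⊥) :
    g ∈ (deepCommutingGraph π).universalVertsᶜ ↔ g ≠ 1 := by
  refine ⟨ne_one_of_mem_compl_universalVerts hπ.ker_le_center, fun hg hdom => hg ?_⟩
  rw [← Subgroup.mem_bot, ← hG, Subgroup.mem_center_iff]
  intro h
  obtain rfl | hne := eq_or_ne g h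
  · rfl
  · exact (DeepCommute.commute hπ.surjective (hdom hne).2).eq.symm

theorem ncard_vertices_coe_mem (hπ : IsCentralExtension π) (hG : Subgroup.center G = ⊥) {s : Set G}
    (hs : 1 ∉ s) : {v : ((deepCommutingGraph π).universalVertsᶜ : Set G) | v.1 ∈ s}.ncard =
      s.ncard :=
  Set.ncard_preimage_of_injective_subset_range Subtype.val_injective fun g hg =>
    ⟨⟨g, (hπ.mem_compl_universalVerts_iff hG).2 fun h => hs (h ▸ hg)⟩, rfl⟩

theorem linked_of_deepCommute (hπ : IsCentralExtension π) (hG : Subgroup.center G = ⊥)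
    (hg : g ≠ 1) (hh : h ≠ 1) (H : DeepCommute π g h) : Linked π g h := by
  refine ⟨(hπ.mem_compl_universalVerts_iff hG).2 hg, (hπ.mem_compl_universalVerts_iff hG).2 hh, ?_⟩
  obtain rfl | hne := eq_or_ne g h
  · rfl
  · exact SimpleGraph.Adj.reachable ⟨hne, H⟩

theorem linked_of_coprime (hπ : IsCentralExtension π) (hG : Subgroup.center G = ⊥) (hg : g ≠ 1)
    (hh : h ≠ 1) (hgh : Commute g h) (ho : (orderOf g).Coprime (orderOf h)) : Linked π g h :=
  hπ.linked_of_deepCommute hG hg hh (hπ.deepCommute_of_coprime hgh ho)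

theorem mem_of_linked_of_centralizer_le (hπ : IsCentralExtension π) {A : Subgroup G}
    (hA : ∀ a ∈ A, a ≠ 1 → Subgroup.centralizer {a} ≤ A) (hg : g ∈ A) (H : Linked π g h) :
    h ∈ A := by
  obtain ⟨hg', hh', hreach⟩ := H
  suffices hmem : ∀ v, (reducedGraph (deepCommutingGraph π)).Reachable ⟨g, hg'⟩ v → v.1 ∈ A from
    hmem _ hreach
  intro v hv
  rw [SimpleGraph.reachable_iff_reflTransGen] at hv
  induction hv with
  | refl => exact hg
  | @tail v w _ hadj hv =>
    have hcomm : Commute v.1 w.1 := DeepCommute.commute hπ.surjective hadj.2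
    exact hA v hv (ne_one_of_mem_compl_universalVerts hπ.ker_le_center v.2)
      (Subgroup.mem_centralizer_singleton_iff.2 hcomm.eq.symm)

end IsCentralExtension

end Linked

section Perm

open Equiv Equiv.Perm Finset

theorem center_perm_eq_bot {α : Type*} (hα : 3 ≤ Cardinal.mk α) :
    Subgroup.center (Perm α) = ⊥ := by
  classical
  refine (Subgroup.eq_bot_iff_forall _).2 fun g hg => Equiv.ext fun a => ?_
  by_contra hga
  rw [Perm.one_apply] at hga
  obtain ⟨c, hcg, hca⟩ := Cardinal.exists_ne_ne_of_three_le hα (g a) a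
  have hcomm := Equiv.congr_fun (Subgroup.mem_center_iff.1 hg (swap a c)) a
  rw [Perm.mul_apply, Perm.mul_apply, swap_apply_left,
    swap_apply_of_ne_of_ne hga (Ne.symm hcg)] at hcomm
  exact hca (g.injective hcomm).symm

theorem center_perm_eq_bot_of_three_le_card {α : Type*} [Fintype α] (hα : 3 ≤ Fintype.card α) :
    Subgroup.center (Perm α) = ⊥ :=
  center_perm_eq_bot (by rw [Cardinal.mk_fintype]; exact_mod_cast hα)

theorem exists_isCycle_disjoint_mul {α : Type*} [Finite α] {g : Perm α} (hg : g ≠ 1) :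
    ∃ c k : Perm α, c.IsCycle ∧ Perm.Disjoint c k ∧ g = c * k := by
  classical
  have := Fintype.ofFinite α
  obtain ⟨c, hc⟩ : g.cycleFactorsFinset.Nonempty :=
    nonempty_iff_ne_empty.2 (mt cycleFactorsFinset_eq_empty_iff.1 hg)
  have hdisj := (disjoint_mul_inv_of_mem_cycleFactorsFinset hc).symm
  exact ⟨c, g * c⁻¹, (mem_cycleFactorsFinset_iff.1 hc).1, hdisj,
    by rw [hdisj.commute.eq, inv_mul_cancel_right]⟩

variable {α : Type*} [Fintype α] {g c c' : Perm α}

theorem exists_notMem_ne_of_card_add_two_le {s : Finset α} (hs : #s + 2 ≤ Fintype.card α) :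
    ∃ a b, a ∉ s ∧ b ∉ s ∧ a ≠ b := by
  classical
  have hcompl : 1 < #sᶜ := by rw [card_compl]; omega
  simpa only [mem_compl] using one_lt_card_iff.1 hcompl

theorem orderOf_le_card_of_prime (hp : (orderOf g).Prime) : orderOf g ≤ Fintype.card α := by
  classical
  exact hp.dvd_factorial.1 (Fintype.card_perm (α := α) ▸ orderOf_dvd_card)

theorem isCycle_of_orderOf_prime (hp : (orderOf g).Prime)
    (hcard : Fintype.card α < 2 * orderOf g) : g.IsCycle := by
  classical
  exact isCycle_of_prime_order hp ((card_le_univ g.support).trans_lt hcard)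

theorem ncard_orderOf_eq_prime {q : ℕ} (hq : q.Prime) (hle : q ≤ Fintype.card α)
    (hlt : Fintype.card α < 2 * q) :
    {g : Perm α | orderOf g = q}.ncard = (q - 1).factorial * (Fintype.card α).choose q := by
  classical
  rw [← card_of_cycleType_singleton hq.two_le hle, ← Set.ncard_coe_finset]
  congr 1
  ext g
  simp only [Set.mem_ofPred_eq, coe_filter, mem_univ, true_and]
  constructor
  · rintro rfl
    have hcyc := isCycle_of_orderOf_prime hq hlt
    rw [hcyc.cycleType, hcyc.orderOf]
  · intro h
    rw [← lcm_cycleType, h, Multiset.lcm_singleton, normalize_eq]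

variable [DecidableEq α]

theorem commute_swap_of_notMem_support {a b : α} (ha : a ∉ g.support) (hb : b ∉ g.support) :
    Commute g (swap a b) := by
  obtain rfl | hab := eq_or_ne a b
  · rw [swap_self]
    exact Commute.one_right g
  · refine (disjoint_iff_disjoint_support.2 ?_).commute
    rw [support_swap hab]
    simp [ha, hb]

theorem exists_isThreeCycle_support_eq {s : Finset α} (hs : #s = 3) :
    ∃ t : Perm α, t.IsThreeCycle ∧ t.support = s := by
  obtain ⟨x, y, z, hxy, hxz, hyz, rfl⟩ := card_eq_three.1 hs
  have hsupp : (swap x y * swap y z).support = {x, y, z} :=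
    support_swap_mul_swap (by simp [hxy, hxz, hyz])
  exact ⟨_, card_support_eq_three_iff.1 (hsupp ▸ hs), hsupp⟩

theorem exists_conj_eq_of_cycleType_eq {s : Finset α} (hc : c.support ⊆ s) (hc' : c'.support ⊆ s)
    (h : c.cycleType = c'.cycleType) : ∃ t : Perm α, t * c * t⁻¹ = c' ∧ t.support ⊆ s := by
  have hrestrict : ∀ d : Perm α, d.support ⊆ s → ∃ d' : Perm {x // x ∈ s}, ofSubtype d' = d := by
    intro d hd
    refine ⟨d.subtypePerm fun x => ?_, ofSubtype_subtypePerm _ fun x hx => hd (mem_support.2 hx)⟩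
    by_cases hx : d x = x
    · rw [hx]
    · have hx' := mem_support.2 hx
      exact iff_of_true (hd (apply_mem_support.2 hx')) (hd hx')
  obtain ⟨d, rfl⟩ := hrestrict c hc
  obtain ⟨d', rfl⟩ := hrestrict c' hc'
  rw [cycleType_ofSubtype, cycleType_ofSubtype] at h
  obtain ⟨t, rfl⟩ := isConj_iff.1 (isConj_iff_cycleType_eq.2 h)
  refine ⟨ofSubtype t, by simp only [map_mul, map_inv], fun x hx => ?_⟩
  by_contra hxs
  exact mem_support.1 hx (ofSubtype_apply_of_not_mem t hxs)

theorem exists_isThreeCycle_disjoint_conj (h2 : g ^ 2 = 1) (h : 4 < #g.support) :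
    ∃ t : Perm α, t.IsThreeCycle ∧ Perm.Disjoint t (g * t * g⁻¹) := by
  have hgg : ∀ x, g (g x) = x := fun x => by rw [← mul_apply, ← pow_two, h2, one_apply]
  obtain ⟨x, hx⟩ : ∃ x, x ∈ g.support := card_pos.1 (by omega)
  obtain ⟨y, hy, hyx⟩ : ∃ y ∈ g.support, y ∉ ({x, g x} : Finset α) :=
    exists_mem_notMem_of_card_lt_card (card_le_two.trans_lt (by omega))
  obtain ⟨z, hz, hzxy⟩ : ∃ z ∈ g.support, z ∉ ({x, g x, y, g y} : Finset α) :=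
    exists_mem_notMem_of_card_lt_card (card_le_four.trans_lt h)
  rw [mem_support] at hx hy hz
  simp only [mem_insert, mem_singleton, not_or] at hyx hzxy
  obtain ⟨t, ht, hsupp⟩ := exists_isThreeCycle_support_eq (s := {x, y, z})
    (card_eq_three.2 ⟨x, y, z, by grind, by grind, by grind, rfl⟩)
  refine ⟨t, ht, disjoint_iff_disjoint_support.2 ?_⟩
  rw [support_conj, hsupp, Finset.disjoint_left]
  intro w hw hgw
  simp only [map_insert, map_singleton, mem_insert, mem_singleton, coe_toEmbedding] at hw hgw
  have hgy := hgg y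
  grind

theorem centralizer_le_zpowers_of_isCycle (hc : c.IsCycle)
    (hcard : Fintype.card α ≤ #c.support + 1) :
    Subgroup.centralizer {c} ≤ Subgroup.zpowers c := by
  intro g hg
  obtain ⟨hsupp, hmem⟩ := hc.commute_iff.1 (Subgroup.mem_centralizer_singleton_iff.1 hg)
  rwa [ofSubtype_subtypePerm] at hmem
  have hcompl : #c.supportᶜ ≤ 1 := by rw [card_compl]; omega
  intro x hgx
  by_contra hx
  exact hgx (card_le_one.1 hcompl _ (by simpa [hsupp] using hx) _ (mem_compl.2 hx))

end Perm

section LinkedSwap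

open Equiv Equiv.Perm Finset

variable {E : Type u} {α : Type v} [Group E] {π : E →* Perm α} {g h : Perm α} {a b c d : α}

namespace IsCentralExtension

theorem deepCommute_of_disjoint_of_odd [Finite α] (hπ : IsCentralExtension π) (ho : Odd (orderOf g))
    (hgh : Perm.Disjoint g h) : DeepCommute π g h := by
  classical
  have := Fintype.ofFinite α
  obtain ⟨t, ht, hsupp⟩ := exists_conj_eq_of_cycleType_eq subset_rfl (support_inv g).subset
    (cycleType_inv g).symm
  have hth : Perm.Disjoint t h := disjoint_iff_disjoint_support.2
    ((disjoint_iff_disjoint_support.1 hgh).mono_left hsupp)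
  exact hπ.deepCommute_of_conj_eq_inv hgh.commute hth.commute ho ht

variable [Fintype α] [DecidableEq α]

theorem linked_swap_of_odd_of_notMem_support (hπ : IsCentralExtension π)
    (hα : 3 ≤ Fintype.card α) (hg : g ≠ 1) (ho : Odd (orderOf g)) (hab : a ≠ b)
    (ha : a ∉ g.support) (hb : b ∉ g.support) : Linked π g (swap a b) := by
  refine hπ.linked_of_coprime (center_perm_eq_bot_of_three_le_card hα) hg
    (mt swap_eq_one_iff.1 hab) (commute_swap_of_notMem_support ha hb) ?_
  rw [(swap_isSwap_iff.2 hab).orderOf]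
  exact ho.coprime_two_right

theorem linked_swap_swap_left (hπ : IsCentralExtension π) (hα : 6 ≤ Fintype.card α)
    (hab : a ≠ b) (hac : a ≠ c) : Linked π (swap a b) (swap a c) := by
  obtain ⟨s, hs, hs3⟩ := exists_subset_card_eq (s := ({a, b, c} : Finset α)ᶜ) (n := 3)
    (by have := card_le_three (a := a) (b := b) (c := c); rw [card_compl]; omega)
  obtain ⟨t, ht, rfl⟩ := exists_isThreeCycle_support_eq hs3
  have hfix : ∀ x ∈ ({a, b, c} : Finset α), x ∉ t.support :=
    fun x hx hxt => mem_compl.1 (hs hxt) hx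
  have hlink : ∀ x ∈ ({a, b, c} : Finset α), a ≠ x → Linked π t (swap a x) := fun x hx hax =>
    hπ.linked_swap_of_odd_of_notMem_support (by omega) ht.isCycle.ne_one
      (by rw [ht.orderOf]; decide) hax (hfix a (by simp)) (hfix x hx)
  exact (hlink b (by simp) hab).symm.trans (hlink c (by simp) hac)

theorem linked_swap_swap (hπ : IsCentralExtension π) (hα : 6 ≤ Fintype.card α)
    (hab : a ≠ b) (hcd : c ≠ d) : Linked π (swap a b) (swap c d) := by
  obtain rfl | hac := eq_or_ne a c
  · exact hπ.linked_swap_swap_left hα hab hcd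
  · have hca : Linked π (swap a c) (swap c d) := by
      rw [swap_comm]
      exact hπ.linked_swap_swap_left hα hac.symm hcd
    exact (hπ.linked_swap_swap_left hα hab hac).trans hca

theorem linked_swap_of_odd_of_card_support_add_two_le (hπ : IsCentralExtension π)
    (hα : 6 ≤ Fintype.card α) (hg : g ≠ 1) (ho : Odd (orderOf g))
    (hsupp : #g.support + 2 ≤ Fintype.card α) (hab : a ≠ b) : Linked π g (swap a b) := by
  obtain ⟨d, e, hd, he, hde⟩ := exists_notMem_ne_of_card_add_two_le hsupp
  exact (hπ.linked_swap_of_odd_of_notMem_support (by omega) hg ho hde hd he).trans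
    (hπ.linked_swap_swap hα hde hab)

theorem linked_swap_of_odd_of_not_isCycle (hπ : IsCentralExtension π)
    (hα : 6 ≤ Fintype.card α) (hg : g ≠ 1) (ho : Odd (orderOf g)) (hcyc : ¬ g.IsCycle)
    (hab : a ≠ b) : Linked π g (swap a b) := by
  obtain ⟨c, k, hc, hck, rfl⟩ := exists_isCycle_disjoint_mul hg
  have hoc : Odd (orderOf c) := by
    rw [hck.orderOf] at ho
    exact ho.of_dvd_nat (Nat.dvd_lcm_left _ _)
  have hk : k ≠ 1 := by
    rintro rfl
    exact hcyc (by rwa [mul_one])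
  have hdeep : DeepCommute π c (c * k) :=
    hπ.deepCommute_mul_right (hπ.deepCommute_of_mem_zpowers (Subgroup.mem_zpowers c))
      (hπ.deepCommute_of_disjoint_of_odd hoc hck)
  have hsupp : #c.support + 2 ≤ Fintype.card α :=
    calc #c.support + 2 ≤ #c.support + #k.support := by
          gcongr; exact two_le_card_support_of_ne_one hk
      _ = #(c * k).support := hck.card_support_mul.symm
      _ ≤ Fintype.card α := card_le_univ _
  exact (hπ.linked_of_deepCommute (center_perm_eq_bot_of_three_le_card (by omega)) hc.ne_one hg
    hdeep).symm.trans (hπ.linked_swap_of_odd_of_card_support_add_two_le hα hc.ne_one hoc hsupp hab)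

theorem linked_swap_of_orderOf_eq_three (hπ : IsCentralExtension π) (hα : 6 ≤ Fintype.card α)
    (hg : orderOf g = 3) (hab : a ≠ b) : Linked π g (swap a b) := by
  have hg1 : g ≠ 1 := fun h => by simp [h] at hg
  have ho : Odd (orderOf g) := hg ▸ by decide
  by_cases hcyc : g.IsCycle
  · refine hπ.linked_swap_of_odd_of_card_support_add_two_le hα hg1 ho ?_ hab
    rw [← hcyc.orderOf, hg]
    omega
  · exact hπ.linked_swap_of_odd_of_not_isCycle hα hg1 ho hcyc hab

theorem linked_swap_of_orderOf_eq_two_of_four_lt (hπ : IsCentralExtension π)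
    (hα : 6 ≤ Fintype.card α) (hg : orderOf g = 2) (hsupp : 4 < #g.support) (hab : a ≠ b) :
    Linked π g (swap a b) := by
  have h2 : g ^ 2 = 1 := hg ▸ pow_orderOf_eq_one g
  obtain ⟨t, ht, hdisj⟩ := exists_isThreeCycle_disjoint_conj h2 hsupp
  have ho : orderOf (t * (g * t * g⁻¹)) = 3 := by
    rw [hdisj.orderOf, ← MulAut.conj_apply, MulEquiv.orderOf_eq, Nat.lcm_self, ht.orderOf]
  have hlink : Linked π g (t * (g * t * g⁻¹)) :=
    hπ.linked_of_coprime (center_perm_eq_bot_of_three_le_card (by omega))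
      (fun h => by simp [h] at hg) (fun h => by simp [h] at ho)
      (commute_mul_conj h2 hdisj.commute) (by rw [hg, ho]; decide)
  exact hlink.trans (hπ.linked_swap_of_orderOf_eq_three hα ho hab)

theorem linked_swap_of_orderOf_eq_two_of_le_four (hπ : IsCentralExtension π)
    (hα : 6 ≤ Fintype.card α) (hg : orderOf g = 2) (hsupp : #g.support ≤ 4) (hab : a ≠ b) :
    Linked π g (swap a b) := by
  have hg1 : g ≠ 1 := fun h => by simp [h] at hg
  obtain ⟨c, k, hc, hck, rfl⟩ := exists_isCycle_disjoint_mul hg1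
  have hoc : orderOf c = 2 := by
    rw [hck.orderOf] at hg
    exact (Nat.prime_two.eq_one_or_self_of_dvd _ (hg ▸ Nat.dvd_lcm_left _ _)).resolve_left
      (mt orderOf_eq_one_iff.1 hc.ne_one)
  have hcs : #c.support = 2 := hc.orderOf ▸ hoc
  obtain rfl | hk := eq_or_ne k 1
  · obtain ⟨x, y, hxy, rfl⟩ := card_support_eq_two.1 hcs
    rw [mul_one]
    exact hπ.linked_swap_swap hα hxy hab
  have hks : #k.support = 2 := by
    have hge := two_le_card_support_of_ne_one hk
    rw [hck.card_support_mul] at hsupp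
    omega
  have hcycle : c.cycleType = k.cycleType := by
    rw [isSwap_iff_cycleType.1 (card_support_eq_two.1 hcs),
      isSwap_iff_cycleType.1 (card_support_eq_two.1 hks)]
  obtain ⟨t, rfl, htsupp⟩ := exists_conj_eq_of_cycleType_eq subset_union_left
    subset_union_right hcycle
  obtain ⟨d, e, hd, he, hde⟩ := exists_notMem_ne_of_card_add_two_le
    (s := (c * (t * c * t⁻¹)).support) (by omega)
  have hcomm : ∀ f : Perm α, f.support ⊆ (c * (t * c * t⁻¹)).support → Commute f (swap d e) :=
    fun f hf => commute_swap_of_notMem_support (fun h => hd (hf h)) fun h => he (hf h)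
  rw [hck.support_mul] at hcomm
  have hdeep : DeepCommute π (c * (t * c * t⁻¹)) (swap d e) :=
    hπ.deepCommute_mul_conj (hcomm c subset_union_left) (hcomm t htsupp)
      (hoc ▸ pow_orderOf_eq_one c)
  exact (hπ.linked_of_deepCommute (center_perm_eq_bot_of_three_le_card (by omega)) hg1
    (mt swap_eq_one_iff.1 hde) hdeep).trans (hπ.linked_swap_swap hα hde hab)

theorem linked_swap_of_orderOf_eq_two (hπ : IsCentralExtension π) (hα : 6 ≤ Fintype.card α)
    (hg : orderOf g = 2) (hab : a ≠ b) : Linked π g (swap a b) := by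
  obtain hsupp | hsupp := le_or_gt #g.support 4
  · exact hπ.linked_swap_of_orderOf_eq_two_of_le_four hα hg hsupp hab
  · exact hπ.linked_swap_of_orderOf_eq_two_of_four_lt hα hg hsupp hab

end IsCentralExtension

end LinkedSwap

section Components

open Equiv Equiv.Perm Finset

theorem ncard_not_reachable_add {V : Type*} [Finite V] (Γ : SimpleGraph V) (v₀ : V) {m : ℕ}
    (h : ∀ v, ¬ Γ.Reachable v₀ v → {w | Γ.Reachable v w}.ncard = m) :
    {v | ¬ Γ.Reachable v₀ v}.ncard + m = Nat.card Γ.ConnectedComponent * m := by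
  classical
  have := Fintype.ofFinite V
  have := Fintype.ofFinite Γ.ConnectedComponent
  have hmaps : ∀ v ∈ ({v | ¬ Γ.Reachable v₀ v} : Finset V),
      Γ.connectedComponentMk v ∈ univ.erase (Γ.connectedComponentMk v₀) := by
    intro v hv
    refine mem_erase.2 ⟨fun hv₀ => (mem_filter.1 hv).2 ?_, mem_univ _⟩
    exact SimpleGraph.ConnectedComponent.exact hv₀.symm
  have hfiber : ∀ C ∈ univ.erase (Γ.connectedComponentMk v₀),
      #{v ∈ ({v | ¬ Γ.Reachable v₀ v} : Finset V) | Γ.connectedComponentMk v = C} = m := by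
    intro C hC
    induction C using SimpleGraph.ConnectedComponent.ind with | _ v
    have hv : ¬ Γ.Reachable v₀ v := fun H =>
      (mem_erase.1 hC).1 (SimpleGraph.ConnectedComponent.sound H.symm)
    rw [← h v hv, ← Set.ncard_coe_finset]
    congr 1
    ext w
    simp only [coe_filter, mem_filter, mem_univ, true_and, Set.mem_ofPred_eq,
      SimpleGraph.ConnectedComponent.eq]
    exact ⟨fun H => H.2.symm, fun H => ⟨fun H₀ => hv (H₀.trans H.symm), H.symm⟩⟩
  have hcount := card_eq_sum_card_fiberwise hmaps
  rw [sum_congr rfl hfiber, sum_const, smul_eq_mul, card_erase_of_mem (mem_univ _), card_univ,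
    ← Nat.card_eq_fintype_card] at hcount
  have hncard : {v | ¬ Γ.Reachable v₀ v}.ncard = #{v | ¬ Γ.Reachable v₀ v} := by
    rw [← Set.ncard_coe_finset, coe_filter_univ]
  have hpos : Nat.card Γ.ConnectedComponent ≠ 0 :=
    have : Nonempty Γ.ConnectedComponent := ⟨Γ.connectedComponentMk v₀⟩
    Nat.card_pos.ne'
  rw [hncard, hcount, ← Nat.succ_mul, Nat.succ_eq_add_one, Nat.sub_add_cancel (by omega)]

variable {E : Type u} {α : Type v} [Group E] [Fintype α] {π : E →* Perm α} {g h : Perm α} {a b : α}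

namespace IsCentralExtension

theorem linked_iff_mem_zpowers (hπ : IsCentralExtension π) (hα : 6 ≤ Fintype.card α)
    (hp : (orderOf g).Prime) (hcard : Fintype.card α ≤ orderOf g + 1) :
    Linked π g h ↔ h ∈ Subgroup.zpowers g ∧ h ≠ 1 := by
  classical
  constructor
  · intro H
    refine ⟨hπ.mem_of_linked_of_centralizer_le (fun x hx hx1 => ?_) (Subgroup.mem_zpowers g) H,
      ne_one_of_mem_compl_universalVerts hπ.ker_le_center H.2.1⟩
    have hxg := orderOf_eq_of_mem_zpowers_of_prime hp hx hx1
    have hcyc : x.IsCycle := isCycle_of_orderOf_prime (hxg ▸ hp) (by omega)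
    exact (centralizer_le_zpowers_of_isCycle hcyc (by rwa [← hcyc.orderOf, hxg])).trans
      (Subgroup.zpowers_le.2 hx)
  · rintro ⟨hh, hh1⟩
    exact hπ.linked_of_deepCommute (center_perm_eq_bot_of_three_le_card (by omega))
      (mt orderOf_eq_one_iff.2 hp.ne_one) hh1 (hπ.deepCommute_of_mem_zpowers hh)

theorem not_linked_swap [DecidableEq α] (hπ : IsCentralExtension π) (hα : 6 ≤ Fintype.card α)
    (hp : (orderOf g).Prime) (hcard : Fintype.card α ≤ orderOf g + 1) (hab : a ≠ b) :
    ¬ Linked π g (swap a b) := by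
  intro H
  obtain ⟨hmem, hne⟩ := (hπ.linked_iff_mem_zpowers hα hp hcard).1 H
  have ho := orderOf_eq_of_mem_zpowers_of_prime hp hmem hne
  rw [(swap_isSwap_iff.2 hab).orderOf] at ho
  omega

theorem linked_swap_of_orderOf_prime [DecidableEq α] (hπ : IsCentralExtension π)
    (hα : 6 ≤ Fintype.card α) (hp : (orderOf g).Prime)
    (hcard : orderOf g + 2 ≤ Fintype.card α) (hab : a ≠ b) : Linked π g (swap a b) := by
  obtain h2 | ho := hp.eq_two_or_odd'
  · exact hπ.linked_swap_of_orderOf_eq_two hα h2 hab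
  have hg : g ≠ 1 := mt orderOf_eq_one_iff.2 hp.ne_one
  by_cases hcyc : g.IsCycle
  · exact hπ.linked_swap_of_odd_of_card_support_add_two_le hα hg ho (hcyc.orderOf ▸ hcard) hab
  · exact hπ.linked_swap_of_odd_of_not_isCycle hα hg ho hcyc hab

theorem linked_swap_iff [DecidableEq α] (hπ : IsCentralExtension π) (hα : 6 ≤ Fintype.card α)
    (hg : g ≠ 1) (hab : a ≠ b) :
    Linked π g (swap a b) ↔ ¬ ((orderOf g).Prime ∧ Fintype.card α ≤ orderOf g + 1) := by
  refine ⟨fun H ⟨hp, hcard⟩ => hπ.not_linked_swap hα hp hcard hab H, fun H => ?_⟩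
  obtain ⟨p, hp, hpg⟩ := Nat.exists_prime_and_dvd (mt orderOf_eq_one_iff.1 hg)
  have hop : orderOf (g ^ (orderOf g / p)) = p := orderOf_pow_orderOf_div (orderOf_pos g).ne' hpg
  have hx1 : g ^ (orderOf g / p) ≠ 1 := fun h => hp.ne_one (by rw [← hop, h, orderOf_one])
  have hlink : Linked π g (g ^ (orderOf g / p)) :=
    hπ.linked_of_deepCommute (center_perm_eq_bot_of_three_le_card (by omega)) hg hx1
      (hπ.deepCommute_of_mem_zpowers (Subgroup.npow_mem_zpowers g _))
  refine hlink.trans (hπ.linked_swap_of_orderOf_prime hα (hop.symm ▸ hp) ?_ hab)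
  by_contra hlt
  have hcard : Fintype.card α ≤ orderOf (g ^ (orderOf g / p)) + 1 := by omega
  obtain ⟨hmem, -⟩ := (hπ.linked_iff_mem_zpowers hα (hop.symm ▸ hp) hcard).1 hlink.symm
  have ho := orderOf_eq_of_mem_zpowers_of_prime (hop.symm ▸ hp) hmem hg
  exact H ⟨by rwa [ho, hop], by rwa [ho]⟩

theorem not_linked_swap_iff_orderOf_eq_prime [DecidableEq α] (hπ : IsCentralExtension π)
    (hα : 6 ≤ Fintype.card α) {q : ℕ} (hq : q.Prime) (hle : q ≤ Fintype.card α)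
    (hcard : Fintype.card α ≤ q + 1) (hg : g ≠ 1) (hab : a ≠ b) :
    ¬ Linked π g (swap a b) ↔ orderOf g = q := by
  rw [hπ.linked_swap_iff hα hg hab, not_not]
  refine ⟨fun ⟨hp, _⟩ => ?_, fun h => h ▸ ⟨hq, hcard⟩⟩
  have hgle := orderOf_le_card_of_prime hp
  have hgodd := hp.eq_two_or_odd
  have hqodd := hq.eq_two_or_odd
  omega

theorem card_connectedComponent (hπ : IsCentralExtension π) (hα : 6 ≤ Fintype.card α) {q : ℕ}
    (hq : q.Prime) (hle : q ≤ Fintype.card α) (hcard : Fintype.card α ≤ q + 1) :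
    Nat.card (reducedGraph (deepCommutingGraph π)).ConnectedComponent =
      (q - 2).factorial * (Fintype.card α).choose q + 1 := by
  classical
  obtain ⟨a, b, hab⟩ := Fintype.one_lt_card_iff.1 (show 1 < Fintype.card α by omega)
  have hG : Subgroup.center (Perm α) = ⊥ := center_perm_eq_bot_of_three_le_card (by omega)
  let v₀ : ((deepCommutingGraph π).universalVertsᶜ : Set (Perm α)) :=
    ⟨swap a b, (hπ.mem_compl_universalVerts_iff hG).2 (mt swap_eq_one_iff.1 hab)⟩
  have hreach : ∀ v, ¬ (reducedGraph (deepCommutingGraph π)).Reachable v₀ v ↔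
      orderOf v.1 = q := fun v => by
    rw [SimpleGraph.reachable_comm, ← linked_coe_iff, hπ.not_linked_swap_iff_orderOf_eq_prime hα hq
      hle hcard (ne_one_of_mem_compl_universalVerts hπ.ker_le_center v.2) hab]
  have hfar : {v | ¬ (reducedGraph (deepCommutingGraph π)).Reachable v₀ v}.ncard =
      (q - 1).factorial * (Fintype.card α).choose q := by
    simp only [hreach]
    rw [← ncard_orderOf_eq_prime hq hle (by omega)]
    exact hπ.ncard_vertices_coe_mem hG (s := {g | orderOf g = q}) fun h =>
      hq.ne_one (h.symm.trans orderOf_one)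
  have hcomponent : ∀ v, ¬ (reducedGraph (deepCommutingGraph π)).Reachable v₀ v →
      {w | (reducedGraph (deepCommutingGraph π)).Reachable v w}.ncard = q - 1 := by
    intro v hv
    obtain rfl := (hreach v).1 hv
    simp only [← linked_coe_iff, hπ.linked_iff_mem_zpowers hα hq hcard]
    rw [← ncard_zpowers_sdiff_one]
    exact hπ.ncard_vertices_coe_mem hG (s := Subgroup.zpowers v.1 \ {1}) fun h => h.2 rfl
  have hcount := ncard_not_reachable_add _ v₀ hcomponent
  have hfactorial : (q - 1).factorial = (q - 1) * (q - 2).factorial :=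
    (Nat.mul_factorial_pred (show q - 1 ≠ 0 by omega)).symm
  refine Nat.eq_of_mul_eq_mul_right (show 0 < q - 1 by omega) ?_
  rw [← hcount, hfar, hfactorial]
  ring

theorem connected_of_not_prime (hπ : IsCentralExtension π) (hα : 6 ≤ Fintype.card α)
    (h0 : ¬ (Fintype.card α).Prime) (h1 : ¬ (Fintype.card α - 1).Prime) :
    (reducedGraph (deepCommutingGraph π)).Connected := by
  classical
  obtain ⟨a, b, hab⟩ := Fintype.one_lt_card_iff.1 (show 1 < Fintype.card α by omega)
  have hG : Subgroup.center (Perm α) = ⊥ := center_perm_eq_bot_of_three_le_card (by omega)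
  refine (SimpleGraph.connected_iff_exists_forall_reachable _).2
    ⟨⟨swap a b, (hπ.mem_compl_universalVerts_iff hG).2 (mt swap_eq_one_iff.1 hab)⟩, fun v => ?_⟩
  rw [SimpleGraph.reachable_comm, ← linked_coe_iff,
    hπ.linked_swap_iff hα (ne_one_of_mem_compl_universalVerts hπ.ker_le_center v.2) hab]
  rintro ⟨hp, hcard⟩
  have hle := orderOf_le_card_of_prime hp
  obtain h | h : orderOf v.1 = Fintype.card α ∨ orderOf v.1 = Fintype.card α - 1 := by omega
  · exact h0 (h ▸ hp)
  · exact h1 (h ▸ hp)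

theorem not_connected_of_prime (hπ : IsCentralExtension π) (hα : 6 ≤ Fintype.card α) {q : ℕ}
    (hq : q.Prime) (hle : q ≤ Fintype.card α) (hcard : Fintype.card α ≤ q + 1) :
    ¬ (reducedGraph (deepCommutingGraph π)).Connected := by
  intro H
  have hone : Nat.card (reducedGraph (deepCommutingGraph π)).ConnectedComponent ≤ 1 :=
    Finite.card_le_one_iff_subsingleton.2 H.preconnected.subsingleton_connectedComponent
  rw [hπ.card_connectedComponent hα hq hle hcard] at hone
  have hpos := Nat.mul_pos (Nat.factorial_pos (q - 2)) (Nat.choose_pos hle)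
  omega

end IsCentralExtension

end Components

end DeepCommuting

theorem mainTheorem11_general {E : Type u} {α : Type v} [Group E] [Fintype α]
    (hα : 6 ≤ Fintype.card α) (π : E →* Equiv.Perm α) (hπ : DeepCommuting.IsCentralExtension π) :
    ((DeepCommuting.reducedGraph (DeepCommuting.deepCommutingGraph π)).Connected ↔
      ¬ (Fintype.card α).Prime ∧ ¬ (Fintype.card α - 1).Prime) ∧
    ((Fintype.card α).Prime →
      Nat.card (DeepCommuting.reducedGraph
        (DeepCommuting.deepCommutingGraph π)).ConnectedComponent =
          Nat.factorial (Fintype.card α - 2) + 1) ∧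
    ((Fintype.card α - 1).Prime →
      Nat.card (DeepCommuting.reducedGraph
        (DeepCommuting.deepCommutingGraph π)).ConnectedComponent =
          Fintype.card α * Nat.factorial (Fintype.card α - 3) + 1) := by
  refine ⟨⟨fun H => ⟨fun hp => ?_, fun hp => ?_⟩, fun H => ?_⟩, fun hp => ?_, fun hp => ?_⟩
  · exact hπ.not_connected_of_prime hα hp le_rfl (by omega) H
  · exact hπ.not_connected_of_prime hα hp (by omega) (by omega) H
  · exact hπ.connected_of_not_prime hα H.1 H.2
  · rw [hπ.card_connectedComponent hα hp le_rfl (by omega), Nat.choose_self, mul_one]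
  · rw [hπ.card_connectedComponent hα hp (by omega) (by omega),
      Nat.choose_symm (show 1 ≤ Fintype.card α by omega), Nat.choose_one_right, mul_comm,
      Nat.sub_sub]

theorem mainTheorem11 (n : ℕ) (hn : 6 ≤ n) {E : Type u} [Group E]
    (π : E →* Equiv.Perm (Fin n)) (hπ : DeepCommuting.IsSchurCover π) :
    ((DeepCommuting.reducedGraph (DeepCommuting.deepCommutingGraph π)).Connected ↔
      ¬ n.Prime ∧ ¬ (n - 1).Prime) ∧
    (¬ (DeepCommuting.reducedGraph (DeepCommuting.deepCommutingGraph π)).Connected →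
      (n.Prime →
        Nat.card (DeepCommuting.reducedGraph
          (DeepCommuting.deepCommutingGraph π)).ConnectedComponent =
            Nat.factorial (n - 2) + 1) ∧
      ((n - 1).Prime →
        Nat.card (DeepCommuting.reducedGraph
          (DeepCommuting.deepCommutingGraph π)).ConnectedComponent =
            n * Nat.factorial (n - 3) + 1)) := by
  obtain ⟨hconn, hprime, hprime'⟩ := mainTheorem11_general (by rwa [Fintype.card_fin]) π
    hπ.isStemExtension.isCentralExtension
  simp only [Fintype.card_fin] at hconn hprime hprime'
  exact ⟨hconn, fun _ => ⟨hprime, hprime'⟩⟩
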